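/- Let $\pi$ be an arbitrary discrete group and $G=\pi\times\pi$. Let $\mathcal D$ be the smallest set of subgroups of $G$ which contains the diagonal $\Delta=\{(a,a): a\in\pi\}$ and the trivial subgroup and is closed under conjugation and under (nonempty) finite intersections. Let $\mathcal{O_D}$ be the orbit category, with objects the left $G$-sets $G/H$, $H\in\mathcal D$, and with $G$-equivariant maps as morphisms. An $\mathcal{O_D}$-module is a contravariant functor from $\mathcal{O_D}$ to abelian groups, $\underline{\mathbb Z}$ is the constant $\mathcal{O_D}$-module with value $\mathbb Z$, and $H^i_{\mathcal D}(G;\underline M)=\mathrm{Ext}^i_{\mathcal{O_D}}(\underline{\mathbb Z},\underline M)$ is Bredon cohomology. Let $\mathrm{cd}_{\mathcal D}(G)\in\{0,1,2,\dots,\infty\}$ be the smallest $n$ such that $H^i_{\mathcal D}(G;\underline M)=0$ for all $i>n$ and all $\mathcal{O_D}$-modules $\underline M$, and let $\mathrm{cd}(\pi)\in\{0,1,2,\dots,\infty\}$ be the smallest $n$ such that $H^i(\pi;M)=0$ for all $i>n$ and all $\mathbb Z[\pi]$-modules $M$. Then $$\mathrm{cd}(\pi)\le \mathrm{cd}_{\mathcal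 D}(\pi\times\pi).$$ -/

import Mathlib

open CategoryTheory

universe u

/-- The diagonal subgroup `Δ = {(a, a)}` of `π × π`. -/
def diagonalSubgroup (π : Type u) [Group π] : Subgroup (π × π) :=
  ((MonoidHom.id π).prod (MonoidHom.id π)).range

/-- The family `𝓓` of subgroups of `π × π`: the smallest set of subgroups which contains the
diagonal and the trivial subgroup and is closed under conjugation and under (nonempty) finite
intersections. -/
inductive MemFamilyD (π : Type u) [Group π] : Subgroup (π × π) → Prop
  | diagonal : MemFamilyD π (diagonalSubgroup π)
  | trivial : MemFamilyD π ⊥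
  | conj (g : π × π) {H : Subgroup (π × π)} :
      MemFamilyD π H → MemFamilyD π (H.map (MulAut.conj g).toMonoidHom)
  | inter {H K : Subgroup (π × π)} : MemFamilyD π H → MemFamilyD π K → MemFamilyD π (H ⊓ K)

/-- The family `𝓓` as a set of subgroups of `π × π`. -/
def familyD (π : Type u) [Group π] : Set (Subgroup (π × π)) := {H | MemFamilyD π H}

/-- Objects of the orbit category of `G` with respect to a set `F` of subgroups; the object given
by `H ∈ F` stands for the transitive left `G`-set `G ⧸ H`. -/
structure OrbitCategory {G : Type u} [Group G] (F : Set (Subgroup G)) : Type u where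
  subgroup : Subgroup G
  mem : subgroup ∈ F

/-- Morphisms of the orbit category are the `G`-equivariant maps `G ⧸ H → G ⧸ K`. -/
instance {G : Type u} [Group G] (F : Set (Subgroup G)) : SmallCategory (OrbitCategory F) where
  Hom X Y := (G ⧸ X.subgroup) →[G] (G ⧸ Y.subgroup)
  id X := MulActionHom.id G
  comp f g := g.comp f

/-- The abelian category of right modules over the orbit category: contravariant functors to
abelian groups. -/
abbrev OrbitModule {G : Type u} [Group G] (F : Set (Subgroup G)) : Type (u + 1) :=
  (OrbitCategory F)ᵒᵖ ⥤ AddCommGrpCat.{u}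

noncomputable section

/-- The constant module `ℤ`: it takes the value `ℤ` on every orbit and the identity on every
morphism. -/
def OrbitModule.constInt {G : Type u} [Group G] (F : Set (Subgroup G)) : OrbitModule F :=
  (Functor.const _).obj (AddCommGrpCat.of (ULift.{u} ℤ))

/-- Bredon cohomology `Hⁿ_F(G; M) = Extⁿ(ℤ, M)`, with `Ext` taken in the category of right modules
over the orbit category. -/
abbrev BredonCohomology {G : Type u} [Group G] {F : Set (Subgroup G)} (M : OrbitModule F) (n : ℕ) :
    Type (u + 1) :=
  letI := HasExt.standard (OrbitModule F)
  Abelian.Ext.{u + 1} (OrbitModule.constInt F) M n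

/-- `cd_F(G)`: the smallest `n` (possibly `∞`) such that `Hⁱ_F(G; M) = 0` for all `i > n` and all
modules `M` over the orbit category. -/
def bredonCohomologicalDimension {G : Type u} [Group G] (F : Set (Subgroup G)) : ℕ∞ :=
  sInf {n : ℕ∞ | ∀ i : ℕ, n < i → ∀ M : OrbitModule F, Subsingleton (BredonCohomology M i)}

/-- `cd(G)`: the smallest `n` (possibly `∞`) such that `Hⁱ(G; M) = 0` for all `i > n` and all
`ℤ[G]`-modules `M`, i.e. `ℤ`-linear representations of `G` (`ULift.{u} ℤ` is the ring `ℤ` placed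
in the universe of `G`). -/
def groupCohomologicalDimension (G : Type u) [Group G] : ℕ∞ :=
  sInf {n : ℕ∞ | ∀ i : ℕ, n < i → ∀ M : Rep.{u} (ULift.{u} ℤ) G,
    Subsingleton (groupCohomology M i)}

end

/-! Let `π` act through `π × 1`. Each member of `𝓓` is trivial or lies in a conjugate of the
diagonal, so this action is free on every orbit `G ⧸ H`. For a `π`-module `M`, the coinduced module
`X ↦ Map_π(X, M)` is right adjoint to evaluation at `G ⧸ 1`, which preserves monomorphisms; so
coinduction preserves injectives. It is exact because the orbits are free `π`-sets, and maps from
the constant module into it correspond to invariants of `M`. Dimension shifting along `0 → M → I → N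
→ 0` with `I` injective then carries the vanishing of Bredon cohomology with coinduced coefficients
over to `H^i(π; M)`. -/

noncomputable section

open Limits

/-! ### Group cohomology and injective modules -/

namespace groupCohomology

variable {k G : Type u} [CommRing k] [Group G]

/-- Injective representations are acyclic for group cohomology. -/
theorem isZero_succ_of_injective (I : Rep.{u} k G) [Injective I] (n : ℕ) :
    IsZero (groupCohomology I (n + 1)) := by
  -- The module coinduced from the trivial subgroup is acyclic by Shapiro's lemma. By injectivity
  -- `I` is a retract of it, so the identity on cohomology factors through zero.
  let S : Subgroup G := ⊥
  let J : Rep.{u} k G := Rep.coind S.subtype (Rep.res S.subtype I)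
  let η : I ⟶ J := (Rep.resCoindAdjunction.{u} k S.subtype).unit.app I
  have : Mono η := inferInstance
  have hJ : IsZero (groupCohomology J (n + 1)) :=
    (isZero_groupCohomology_succ_of_subsingleton (Rep.res S.subtype I) n).of_iso
      (groupCohomology.coindIso (Rep.res S.subtype I) (n + 1))
  let r : J ⟶ I := Injective.factorThru (𝟙 I) η
  rw [IsZero.iff_id_eq_zero]
  have h : (functor k G (n + 1)).map η ≫ (functor k G (n + 1)).map r = 𝟙 _ := by
    rw [← Functor.map_comp, Injective.comp_factorThru, CategoryTheory.Functor.map_id]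
  have h₀ : (functor k G (n + 1)).map η = 0 := IsZero.eq_of_tgt hJ _ _
  rw [h₀, zero_comp] at h
  exact h.symm

instance : EnoughInjectives (Rep.{u} k G) :=
  EnoughInjectives.of_equivalence (Rep.equivalenceModuleMonoidAlgebra (k := k) (G := G)).functor

/-- `H¹(G, X₁)` vanishes if `X₂` is injective and invariants lift along `X₂ ⟶ X₃`. -/
theorem subsingleton_one_of_invariants_lift {X : ShortComplex (Rep.{u} k G)} (hX : X.ShortExact)
    [Injective X.X₂]
    (h : ∀ z : X.X₃, (∀ g, X.X₃.ρ g z = z) → ∃ y : X.X₂, (∀ g, X.X₂.ρ g y = y) ∧ X.g.hom y = z) :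
    Subsingleton (groupCohomology X.X₁ 1) := by
  refine subsingleton_of_forall_eq 0 fun c => ?_
  have := epi_δ_of_isZero hX 0 (isZero_succ_of_injective _ _)
  obtain ⟨x, rfl⟩ := (ModuleCat.epi_iff_surjective _).1 this c
  obtain ⟨z, rfl⟩ : ∃ z, (H0Iso X.X₃).inv z = x := ⟨(H0Iso X.X₃).hom x, by simp⟩
  obtain ⟨y, hy, hyz⟩ := h z.1 z.2
  -- Since the lift `y` is invariant, its coboundary vanishes and the zero cocycle represents the
  -- connecting image of `z`.
  have hx : X.f.hom ∘ (0 : G → X.X₁) = d₀₁ X.X₂ y := by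
    ext g
    simp [hy]
  rw [δ₀_apply hX z y hyz 0 hx]
  exact map_zero (H1π X.X₁).hom

end groupCohomology

/-! ### Maps out of the free orbit -/

namespace OrbitCategory

variable {G : Type u} [Group G] {F : Set (Subgroup G)}

@[ext]
theorem hom_ext {X Y : OrbitCategory F} {f g : X ⟶ Y}
    (h : ∀ x : G ⧸ X.subgroup, f.toFun x = g.toFun x) : f = g :=
  MulActionHom.ext h

@[simp]
theorem comp_toFun {X Y Z : OrbitCategory F} (f : X ⟶ Y) (g : Y ⟶ Z) (x : G ⧸ X.subgroup) :
    (f ≫ g).toFun x = g.toFun (f.toFun x) := rfl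

@[simp]
theorem id_toFun (X : OrbitCategory F) (x : G ⧸ X.subgroup) :
    MulActionHom.toFun (𝟙 X : X ⟶ X) x = x := rfl

theorem toFun_smul {X Y : OrbitCategory F} (f : X ⟶ Y) (g : G) (x : G ⧸ X.subgroup) :
    f.toFun (g • x) = g • f.toFun x := f.map_smul' g x

/-- The free orbit `G ⧸ ⊥`. -/
def free (h : ⊥ ∈ F) : OrbitCategory F := ⟨⊥, h⟩

variable (h : ⊥ ∈ F)

/-- The class of a group element in the free orbit. -/
def freeMk (g : G) : G ⧸ (free h).subgroup := QuotientGroup.mk g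

theorem smul_freeMk (g a : G) : g • freeMk h a = freeMk h (g * a) := rfl

/-- The equivariant map from the free orbit to an orbit given by a point of the latter. -/
def ofPoint {X : OrbitCategory F} (x : G ⧸ X.subgroup) : free h ⟶ X :=
  ({ toFun := fun q => Quotient.liftOn' q (fun g => g • x) (fun a b hab => by
      have : a = b := by
        rw [QuotientGroup.leftRel_apply] at hab
        exact (inv_mul_eq_one.1 (Subgroup.mem_bot.1 hab))
      rw [this])
     map_smul' := fun g q => by
      induction q using QuotientGroup.induction_on with
      | H a => exact mul_smul g a x } :
    (G ⧸ (free h).subgroup) →[G] (G ⧸ X.subgroup))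

@[simp]
theorem ofPoint_freeMk {X : OrbitCategory F} (x : G ⧸ X.subgroup) (g : G) :
    (ofPoint h x).toFun (freeMk h g) = g • x := rfl

theorem ofPoint_freeMk_base (g : G) :
    (ofPoint h (freeMk h g)).toFun (freeMk h 1) = g • freeMk h 1 := by
  rw [ofPoint_freeMk, one_smul, smul_freeMk, mul_one]

theorem free_hom_ext {X : OrbitCategory F} {f f' : free h ⟶ X}
    (hf : f.toFun (freeMk h 1) = f'.toFun (freeMk h 1)) : f = f' := by
  ext x
  induction x using QuotientGroup.induction_on with
  | H a =>
    have : (QuotientGroup.mk a : G ⧸ (free h).subgroup) = a • freeMk h 1 := by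
      rw [smul_freeMk, mul_one, freeMk]
    rw [this, toFun_smul, toFun_smul, hf]

theorem ofPoint_comp {X Y : OrbitCategory F} (x : G ⧸ X.subgroup) (f : X ⟶ Y) :
    ofPoint h x ≫ f = ofPoint h (f.toFun x) :=
  free_hom_ext h (by simp)

/-- For a point of the free orbit the map is right multiplication, which reverses products of
functions; a contravariant functor turns this into a left action. -/
theorem ofPoint_freeMk_comp {X : OrbitCategory F} (g : G) (x : G ⧸ X.subgroup) :
    ofPoint h (freeMk h g) ≫ ofPoint h x = ofPoint h (g • x) := by
  rw [ofPoint_comp, ofPoint_freeMk]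

theorem ofPoint_freeMk_one : ofPoint h (freeMk h 1) = 𝟙 (free h) :=
  free_hom_ext h (by simp)

end OrbitCategory

/-- An equivariant additive map between representations over a quotient ring of `ℤ`, as a morphism
of representations. -/
def Rep.homMk {k P : Type u} [Ring k] [Monoid P] (hk : Function.Surjective (Int.cast : ℤ → k))
    {A B : Rep.{u} k P} (f : A →+ B) (hf : ∀ p a, f (A.ρ p a) = B.ρ p (f a)) : A ⟶ B :=
  Rep.ofHom
    { toFun := f
      map_add' := map_add f
      map_smul' := fun c a => by
        obtain ⟨z, rfl⟩ := hk c
        simp [Int.cast_smul_eq_zsmul]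
      isIntertwining' := fun p => LinearMap.ext fun a => hf p a }

theorem Rep.hom_ext_apply {k P : Type u} [Ring k] [Monoid P] {A B : Rep.{u} k P} {f g : A ⟶ B}
    (h : ∀ a, f.hom a = g.hom a) : f = g :=
  Rep.hom_ext (DFunLike.ext _ _ h)

/-! ### Coinduction and its adjunction -/

namespace OrbitModule

variable {P G : Type u} [Group P] [Group G] {F : Set (Subgroup G)}

/-- The equivariant functions on an orbit of `G` with values in a representation of a group `P`
that acts through a homomorphism `ι : P →* G`. -/
def equivariantFunctions (ι : P →* G) (M : Rep.{u} (ULift.{u} ℤ) P) (X : OrbitCategory F) :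
    AddSubgroup (G ⧸ X.subgroup → M) where
  carrier := {f | ∀ p x, f (ι p • x) = M.ρ p (f x)}
  add_mem' hf hg p x := by simp [hf p x, hg p x]
  zero_mem' p x := by simp
  neg_mem' hf p x := by simp [hf p x]

/-- The coinduction functor, right adjoint to evaluation at the free orbit. -/
def coind (F : Set (Subgroup G)) (ι : P →* G) : Rep.{u} (ULift.{u} ℤ) P ⥤ OrbitModule F where
  obj M :=
    { obj := fun X => AddCommGrpCat.of (equivariantFunctions ι M X.unop)
      map := fun {X Y} f => AddCommGrpCat.ofHom
        { toFun := fun s => ⟨fun y => s.1 (f.unop.toFun y), fun p x => by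
            beta_reduce; rw [OrbitCategory.toFun_smul]; exact s.2 p _⟩
          map_zero' := rfl
          map_add' := fun _ _ => rfl }
      map_id := fun _ => rfl
      map_comp := fun _ _ => rfl }
  map {M N} φ :=
    { app := fun X => AddCommGrpCat.ofHom
        { toFun := fun s => ⟨fun x => φ.hom (s.1 x), fun p x => by
            beta_reduce; rw [s.2 p x]; exact Rep.hom_comm_apply φ p _⟩
          map_zero' := Subtype.ext (funext fun _ => map_zero _)
          map_add' := fun _ _ => Subtype.ext (funext fun _ => map_add _ _ _) }
      naturality := fun _ _ _ => rfl }
  map_id _ := rfl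
  map_comp _ _ := rfl

instance (ι : P →* G) : (coind F ι).Additive where
  map_add := rfl

/-- The representation of `P` on the value of a module at the free orbit. -/
def evalFree (h : ⊥ ∈ F) (ι : P →* G) : OrbitModule F ⥤ Rep.{u} (ULift.{u} ℤ) P where
  obj N := Rep.of (X := N.obj (.op (OrbitCategory.free h)))
    { toFun := fun p =>
        { toFun := N.map (OrbitCategory.ofPoint h (OrbitCategory.freeMk h (ι p))).op
          map_add' := map_add _
          map_smul' := fun c x => map_zsmul _ c.down x }
      map_one' := by
        ext x
        simp [OrbitCategory.ofPoint_freeMk_one]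
      map_mul' := fun p q => by
        ext x
        have : OrbitCategory.ofPoint h (OrbitCategory.freeMk h (ι (p * q))) =
          OrbitCategory.ofPoint h (OrbitCategory.freeMk h (ι p)) ≫
            OrbitCategory.ofPoint h (OrbitCategory.freeMk h (ι q)) := by
          rw [OrbitCategory.ofPoint_freeMk_comp, map_mul]; rfl
        change N.map (OrbitCategory.ofPoint h (OrbitCategory.freeMk h (ι (p * q)))).op x = _
        rw [this, op_comp, Functor.map_comp]
        rfl }
  map {N N'} φ := Rep.ofHom
    { toFun := φ.app _
      map_add' := map_add _
      map_smul' := fun c x => map_zsmul _ c.down x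
      isIntertwining' := fun p => by
        ext x
        exact NatTrans.naturality_apply φ _ x }
  map_id _ := rfl
  map_comp _ _ := rfl

/-- Coinduction is right adjoint to evaluation at the free orbit. -/
def evalFreeCoindAdjunction (h : ⊥ ∈ F) (ι : P →* G) : evalFree h ι ⊣ coind F ι :=
  Adjunction.mkOfHomEquiv
    { homEquiv := fun N M =>
        -- As in the Yoneda lemma: a point `x` pulls `n` back to the free orbit, where `φ` applies;
        -- the inverse evaluates at the base point.
        { toFun := fun φ =>
            { app := fun X => AddCommGrpCat.ofHom
                { toFun := fun n => ⟨fun x => φ.hom (N.map (OrbitCategory.ofPoint h x).op n),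
                    fun p x => by
                      have := Rep.hom_comm_apply φ p (N.map (OrbitCategory.ofPoint h x).op n)
                      refine Eq.trans ?_ this
                      change φ.hom (N.map (OrbitCategory.ofPoint h (ι p • x)).op n) = _
                      rw [← OrbitCategory.ofPoint_freeMk_comp, op_comp, Functor.map_comp]
                      rfl⟩
                  map_zero' := Subtype.ext (funext fun x => by simp; exact map_zero φ.hom)
                  map_add' := fun a b => Subtype.ext (funext fun x => by
                    simp; exact map_add φ.hom _ _) }
              naturality := fun X Y f => by
                ext n
                refine Subtype.ext (funext fun x => ?_)
                have := OrbitCategory.ofPoint_comp h x f.unop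
                change φ.hom (N.map _ (N.map f n)) = φ.hom (N.map _ n)
                rw [← this, op_comp, Functor.map_comp]
                rfl }
          invFun := fun ψ => Rep.homMk (fun c => ⟨c.down, by ext; simp⟩)
            { toFun := fun n => (ψ.app (.op (OrbitCategory.free h)) n).1 (OrbitCategory.freeMk h 1)
              map_zero' := congrArg (fun s => s.1 (OrbitCategory.freeMk h 1))
                (map_zero (ψ.app (.op (OrbitCategory.free h))).hom)
              map_add' := fun a b => congrArg (fun s => s.1 (OrbitCategory.freeMk h 1))
                (map_add (ψ.app (.op (OrbitCategory.free h))).hom a b) }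
            (fun p n => by
              have h₁ := congrArg (fun s => s.1 (OrbitCategory.freeMk h 1))
                (NatTrans.naturality_apply ψ
                  (OrbitCategory.ofPoint h (OrbitCategory.freeMk h (ι p))).op n)
              refine h₁.trans ?_
              refine Eq.trans ?_ ((ψ.app _ n).2 p (OrbitCategory.freeMk h 1))
              exact congrArg (ψ.app (.op (OrbitCategory.free h)) n).1
                (OrbitCategory.ofPoint_freeMk_base h (ι p)))
          left_inv := fun φ => by
            refine Rep.hom_ext_apply fun n => ?_
            change φ.hom (N.map _ n) = φ.hom n
            rw [OrbitCategory.ofPoint_freeMk_one, op_id, CategoryTheory.Functor.map_id]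
            rfl
          right_inv := fun ψ => by
            refine NatTrans.ext (funext fun X => AddCommGrpCat.ext fun n => ?_)
            refine Subtype.ext (funext fun x => ?_)
            have h₁ := congrArg (fun s => s.1 (OrbitCategory.freeMk h 1))
                  (NatTrans.naturality_apply ψ (OrbitCategory.ofPoint h x).op n)
            refine h₁.trans ?_
            change (ψ.app X n).1 _ = _
            simp }
      homEquiv_naturality_left_symm := fun _ _ => rfl
      homEquiv_naturality_right := fun _ _ => rfl }

instance (h : ⊥ ∈ F) (ι : P →* G) : (evalFree h ι).PreservesMonomorphisms where
  preserves f hf := by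
    rw [Rep.mono_iff_injective]
    have := (NatTrans.mono_iff_mono_app f).1 hf (.op (OrbitCategory.free h))
    exact (AddCommGrpCat.mono_iff_injective _).1 this

theorem injective_coind (h : ⊥ ∈ F) (ι : P →* G) (I : Rep.{u} (ULift.{u} ℤ) P) [Injective I] :
    Injective ((coind F ι).obj I) :=
  (evalFreeCoindAdjunction h ι).map_injective I inferInstance

end OrbitModule
theorem exists_shortExact_injective {C : Type*} [Category* C] [Abelian C] [EnoughInjectives C]
    (X : C) : ∃ (I Y : C) (f : X ⟶ I) (g : I ⟶ Y) (w : f ≫ g = 0),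
      (ShortComplex.mk f g w).ShortExact ∧ Injective I :=
  ⟨Injective.under X, cokernel (Injective.ι X), Injective.ι X, cokernel.π _, cokernel.condition _,
    { exact := ShortComplex.exact_cokernel _
      mono_f := inferInstanceAs (Mono (Injective.ι X))
      epi_g := inferInstanceAs (Epi (cokernel.π (Injective.ι X))) }, inferInstance⟩

/-! ### Exactness of coinduction and dimension shifting -/

namespace OrbitModule

variable {P G : Type u} [Group P] [Group G] {F : Set (Subgroup G)}

/-- Equivariant functions on a free `P`-set lift along surjections of representations. -/
theorem exists_lift_equivariantFunctions (ι : P →* G) {X : OrbitCategory F}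
    (hfree : ∀ (p : P) (x : G ⧸ X.subgroup), ι p • x = x → p = 1)
    {M N : Rep.{u} (ULift.{u} ℤ) P} (φ : M ⟶ N) (hφ : Function.Surjective φ.hom)
    (s : equivariantFunctions ι N X) :
    ∃ t : equivariantFunctions ι M X, ∀ x, φ.hom (t.1 x) = s.1 x := by
  -- Pick a representative of each `P`-orbit, lift the value there and extend equivariantly.
  -- Freeness makes the translating element `a x` unique, hence `a` equivariant.
  let r : Setoid (G ⧸ X.subgroup) :=
    { r := fun x y => ∃ p, ι p • y = x
      iseqv := ⟨fun x => ⟨1, by simp⟩, fun {x y} ⟨p, h⟩ => ⟨p⁻¹, by simp [← h]⟩,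
        fun {x y z} ⟨p, h⟩ ⟨q, h'⟩ => ⟨p * q, by rw [map_mul, mul_smul, h', h]⟩⟩ }
  let rep : G ⧸ X.subgroup → G ⧸ X.subgroup := fun x => (Quotient.mk r x).out
  have hrep (x) : ∃ p, ι p • rep x = x := r.symm (Quotient.mk_out (s := r) x)
  have hrep_smul (q x) : rep (ι q • x) = rep x :=
    congrArg Quotient.out (Quotient.sound (s := r) ⟨q, rfl⟩)
  choose a ha using hrep
  choose l hl using hφ
  have ha_smul (q x) : a (ι q • x) = q * a x := by
    have h₁ : ι ((q * a x)⁻¹ * a (ι q • x)) • rep x = rep x := by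
      have := ha (ι q • x)
      rw [hrep_smul] at this
      rw [map_mul, mul_smul, this, map_inv, inv_smul_eq_iff, map_mul, mul_smul, ha]
    exact (inv_mul_eq_one.1 (hfree _ _ h₁)).symm
  refine ⟨⟨fun x => M.ρ (a x) (l (s.1 (rep x))), fun q x => ?_⟩, fun x => ?_⟩
  · beta_reduce
    rw [ha_smul, hrep_smul, map_mul]
    rfl
  · beta_reduce
    rw [Rep.hom_comm_apply, hl, ← s.2, ha]

variable (h : ⊥ ∈ F) (ι : P →* G)
  (hfree : ∀ (X : OrbitCategory F) (p : P) (x : G ⧸ X.subgroup), ι p • x = x → p = 1)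

include hfree in
theorem preservesEpimorphisms_coind : (coind F ι).PreservesEpimorphisms where
  preserves φ hφ := by
    rw [NatTrans.epi_iff_epi_app]
    intro X
    rw [AddCommGrpCat.epi_iff_surjective]
    intro s
    obtain ⟨t, ht⟩ := exists_lift_equivariantFunctions ι (hfree X.unop) φ
      ((Rep.epi_iff_surjective φ).1 hφ) s
    exact ⟨t, Subtype.ext (funext ht)⟩

include h hfree in
theorem shortExact_map_coind {S : ShortComplex (Rep.{u} (ULift.{u} ℤ) P)} (hS : S.ShortExact) :
    (S.map (coind F ι)).ShortExact := by
  have := preservesEpimorphisms_coind ι hfree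
  have := (evalFreeCoindAdjunction h ι).rightAdjoint_preservesLimits
  have := (coind F ι).preservesHomology_of_preservesEpis_and_kernels
  have := hS.mono_f
  have := hS.epi_g
  have : (coind F ι).PreservesMonomorphisms := inferInstance
  exact hS.map (coind F ι)

/-- The morphism from the constant module given by an invariant element. -/
def constIntHom (M : Rep.{u} (ULift.{u} ℤ) P) (m : M) (hm : ∀ p, M.ρ p m = m) :
    constInt F ⟶ (coind F ι).obj M where
  app X := AddCommGrpCat.ofHom
    { toFun := fun c => ⟨fun _ => c.down • m, fun p x => by rw [map_zsmul, hm]⟩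
      map_zero' := Subtype.ext (funext fun _ => zero_smul _ _)
      map_add' := fun _ _ => Subtype.ext (funext fun _ => add_smul _ _ _) }
  naturality _ _ _ := rfl

/-- The element at the base point of the free orbit given by a morphism from the constant
module. -/
def constIntEval {M : Rep.{u} (ULift.{u} ℤ) P} (ψ : constInt F ⟶ (coind F ι).obj M) : M :=
  (ψ.app (.op (OrbitCategory.free h)) (ULift.up (1 : ℤ))).1 (OrbitCategory.freeMk h 1)

theorem constIntEval_invariant {M : Rep.{u} (ULift.{u} ℤ) P}
    (ψ : constInt F ⟶ (coind F ι).obj M) (p : P) :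
    M.ρ p (constIntEval h ι ψ) = constIntEval h ι ψ := by
  have h₁ := congrArg (fun s => s.1 (OrbitCategory.freeMk h 1))
    (NatTrans.naturality_apply ψ
      (OrbitCategory.ofPoint h (OrbitCategory.freeMk h (ι p))).op (ULift.up (1 : ℤ)))
  refine Eq.trans ?_ h₁.symm
  refine Eq.trans ((ψ.app _ _).2 p (OrbitCategory.freeMk h 1)).symm ?_
  exact congrArg (ψ.app (.op (OrbitCategory.free h)) (ULift.up (1 : ℤ))).1
    (OrbitCategory.ofPoint_freeMk_base h (ι p)).symm

include h hfree in
/-- Vanishing of Bredon cohomology with coinduced coefficients implies vanishing of group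
cohomology. -/
theorem subsingleton_groupCohomology_of_coind (i : ℕ) (M : Rep.{u} (ULift.{u} ℤ) P)
    (hM : Subsingleton (BredonCohomology ((coind F ι).obj M) (i + 1))) :
    Subsingleton (groupCohomology M (i + 1)) := by
  let := HasExt.standard (OrbitModule F)
  induction i generalizing M with
  | zero =>
    obtain ⟨I, N, f, g, w, hS, hI⟩ := exists_shortExact_injective M
    have hS' := shortExact_map_coind h ι hfree hS
    refine groupCohomology.subsingleton_one_of_invariants_lift hS fun z hz => ?_
    -- As `Ext¹` vanishes, the map `ℤ → coind N` given by `z` lifts to `coind I`; its value at the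
    -- base point is the invariant lift sought.
    obtain ⟨e, he⟩ := Abelian.Ext.covariant_sequence_exact₃ (constInt F) hS'
      (Abelian.Ext.mk₀ (constIntHom ι N z hz)) (zero_add 1) (hM.elim _ _)
    obtain ⟨ψ, rfl⟩ := (Abelian.Ext.mk₀_bijective _ _).2 e
    rw [Abelian.Ext.mk₀_comp_mk₀] at he
    have hψ := (Abelian.Ext.mk₀_bijective _ _).1 he
    refine ⟨constIntEval h ι ψ, constIntEval_invariant h ι ψ, ?_⟩
    have := congrArg (constIntEval h ι) hψ
    exact this.trans (one_smul _ z)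
  | succ i ih =>
    obtain ⟨I, N, f, g, w, hS, hI⟩ := exists_shortExact_injective M
    have hS' := shortExact_map_coind h ι hfree hS
    have h₁ : Subsingleton (groupCohomology N (i + 1)) := by
      refine ih N ?_
      refine subsingleton_of_forall_eq 0 fun x => ?_
      -- Each class for `N` comes from one for `I`, which is zero since `coind I` is injective.
      obtain ⟨y, rfl⟩ := Abelian.Ext.covariant_sequence_exact₃ (constInt F) hS' x
        (rfl : i + 1 + 1 = i + 2) (hM.elim _ _)
      have := injective_coind h ι I
      have hy : y = 0 := Abelian.Ext.eq_zero_of_injective (I := (coind F ι).obj I) y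
      rw [hy, Abelian.Ext.zero_comp]
      rfl
    have := groupCohomology.epi_δ_of_isZero hS (i + 1)
      (groupCohomology.isZero_succ_of_injective _ _)
    exact ((ModuleCat.epi_iff_surjective _).1 this).subsingleton

include h hfree in
theorem groupCohomologicalDimension_le_bredonCohomologicalDimension :
    groupCohomologicalDimension P ≤ bredonCohomologicalDimension F := by
  refine sInf_le_sInf fun n hn i hi M => ?_
  -- Degree zero never occurs, because `n < i` forces `i` to be positive.
  obtain ⟨j, rfl⟩ := Nat.exists_eq_succ_of_ne_zero (n := i)
    (fun h0 => by subst h0; exact not_lt_bot (α := ℕ∞) hi)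
  exact subsingleton_groupCohomology_of_coind h ι hfree j M (hn _ hi _)

end OrbitModule

/-! ### Freeness for the family `𝓓` -/

/-- Every member of the family `𝓓` is trivial or contained in a conjugate of the diagonal, so that
it meets `π × 1` trivially. -/
theorem eq_one_of_mem_familyD {π : Type u} [Group π] {H : Subgroup (π × π)} (hH : H ∈ familyD π)
    (p : π) (hp : (p, 1) ∈ H) : p = 1 := by
  -- This form also covers the trivial subgroup, and it survives conjugation and passing to
  -- subgroups, which makes the induction work.
  suffices ∃ c : π, ∀ x ∈ H, x.1 = c * x.2 * c⁻¹ by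
    obtain ⟨c, hc⟩ := this
    simpa using hc _ hp
  clear hp
  change MemFamilyD π H at hH
  induction hH with
  | diagonal =>
    refine ⟨1, ?_⟩
    rintro _ ⟨a, rfl⟩
    simp
  | trivial =>
    refine ⟨1, fun x hx => ?_⟩
    rw [Subgroup.mem_bot.1 hx]
    simp
  | conj g _ ih =>
    obtain ⟨c, hc⟩ := ih
    refine ⟨g.1 * c * g.2⁻¹, ?_⟩
    rintro _ ⟨x, hx, rfl⟩
    simp [hc x hx, mul_assoc]
  | inter _ _ ih _ =>
    obtain ⟨c, hc⟩ := ih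
    exact ⟨c, fun x hx => hc x hx.1⟩

theorem eq_one_of_inl_smul_eq_self {π : Type u} [Group π] (X : OrbitCategory (familyD π)) (p : π)
    (x : (π × π) ⧸ X.subgroup) (hx : MonoidHom.inl π π p • x = x) : p = 1 := by
  induction x using QuotientGroup.induction_on with
  | H g =>
    -- The stabiliser of the coset `gH` is `gHg⁻¹`.
    have h₁ : g⁻¹ * (MonoidHom.inl π π p * g) ∈ X.subgroup := QuotientGroup.eq.1 hx.symm
    have h₂ : (g.1⁻¹ * (p * g.1), (1 : π)) ∈ X.subgroup := by
      convert h₁ using 1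
      ext <;> simp
    have h₃ := eq_one_of_mem_familyD X.mem _ h₂
    rwa [inv_mul_eq_one, eq_comm, mul_eq_right] at h₃

end

theorem mainTheorem9 (π : Type u) [Group π] :
    groupCohomologicalDimension π ≤ bredonCohomologicalDimension (familyD π) :=
  OrbitModule.groupCohomologicalDimension_le_bredonCohomologicalDimension
    MemFamilyD.trivial (MonoidHom.inl π π) eq_one_of_inl_smul_eq_self
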